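/- Let $A$ be a finite alphabet. A shift space is a closed set $X\subseteq A^{\mathbb N}$ (product topology, $A$ discrete) with $\sigma(X)=X$, where $\sigma$ is the map that removes the first symbol of a sequence. Its entropy is $h(X)=\lim_{n\to\infty}\frac1n\log\#\{w\in A^n : w \text{ is a factor of a sequence in } X\}$. An automaton $\mathcal A=\langle Q,A,\Delta,I,F\rangle$ has a finite state set $Q$, a transition relation $\Delta\subseteq Q\times A\times Q$, initial states $I\subseteq Q$ and final states $F\subseteq Q$; it accepts the set of all sequences that label an infinite run which starts in $I$ and visits $F$ infinitely often. It is strongly connected if for all states $p,q$ there is a finite run from $p$ to $q$. It is unambiguous if for all states $p,q$ and each finite word $w$ there is at most one run from $p$ to $q$ labelled by $w$. Its adjacency matrix is the $Q\times Q$ matrix with entries $M_{p,q}=\#\{a\in A : (p,a,q)\in\Delta\}$. A shift space is irreducible sofic if it is the set accepted by some strongly connected automaton. **Theorem.** Let $X\subseteq A^{\mathbb N}$ be a shift space of entropy $h$ and let $\mathcal A$ be a strongly connected automaton over $A$ that accepts a nonempty shift space contained in $X$. Consider the properties (i) $\mathcal A$ is unambiguous; (ii) $\mathcal A$ accepts $X$;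 (iii) the logarithm of the spectral radius of the adjacency matrix of $\mathcal A$ is $h$. Then (i) and (ii) imply (iii), and (ii) and (iii) imply (i). If moreover $X$ is an irreducible sofic shift, then (i) and (iii) imply (ii). In particular, if $X$ is an irreducible sofic shift, any two of the three properties imply the third. -/

import Mathlib

open Filter Topology

namespace SymbolicDynamicsAutomata

/-- The shift map on one-sided sequences: it removes the first symbol. -/
def shift {A : Type*} (x : ℕ → A) : ℕ → A := fun i => x (i + 1)

/-- A shift space: a closed set `X` of sequences (for the product topology, `A` being discrete in
all uses) such that `σ(X) = X`. -/
structure IsShiftSpace {A : Type*} [TopologicalSpace A] (X : Set (ℕ → A)) : Prop where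
  isClosed : IsClosed X
  shift_image : shift '' X = X

/-- The factors of length `n` of the sequences in `X`, i.e. `fact(X) ∩ Aⁿ`. -/
def factors {A : Type*} (X : Set (ℕ → A)) (n : ℕ) : Set (Fin n → A) :=
  {w | ∃ x ∈ X, ∃ k : ℕ, ∀ i : Fin n, w i = x (k + i)}

/-- The entropy `h(X) = lim log #(fact(X) ∩ Aⁿ) / n` (the limit always exists for nonempty `X`, see
`tendsto_entropy`). -/
noncomputable def entropy {A : Type*} (X : Set (ℕ → A)) : ℝ :=
  limUnder atTop (fun n : ℕ => Real.log ((factors X n).ncard : ℝ) / n)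

theorem factors_nonempty {A : Type*} {X : Set (ℕ → A)} (hX : X.Nonempty) (n : ℕ) :
    (factors X n).Nonempty := by
  obtain ⟨x, hx⟩ := hX
  exact ⟨fun i => x (0 + i), x, hx, 0, fun _ => rfl⟩

theorem factors_ncard_add_le {A : Type*} [Finite A] (X : Set (ℕ → A)) (m n : ℕ) :
    (factors X (m + n)).ncard ≤ (factors X m).ncard * (factors X n).ncard := by
  rw [← Set.ncard_prod]
  refine Set.ncard_le_ncard_of_injOn
    (fun w => (fun i => w (Fin.castAdd n i), fun i => w (Fin.natAdd m i))) ?_ ?_ (Set.toFinite _)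
  · rintro w ⟨x, hx, k, hk⟩
    refine ⟨⟨x, hx, k, fun i => by simp [hk]⟩, ⟨x, hx, k + m, fun i => ?_⟩⟩
    simp [hk, Nat.add_assoc]
  · intro v _ w _ h
    simp only [Prod.mk.injEq] at h
    funext i
    refine Fin.addCases (fun j => congrFun h.1 j) (fun j => congrFun h.2 j) i

/-- The limit in the definition of the entropy exists. -/
theorem tendsto_entropy {A : Type*} [Finite A] {X : Set (ℕ → A)} (hX : X.Nonempty) :
    Tendsto (fun n : ℕ => Real.log ((factors X n).ncard : ℝ) / n) atTop (𝓝 (entropy X)) := by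
  have hpos : ∀ n, 0 < (factors X n).ncard := fun n =>
    (Set.ncard_pos (Set.toFinite _)).2 (factors_nonempty hX n)
  have hsub : Subadditive (fun n : ℕ => Real.log ((factors X n).ncard : ℝ)) := by
    intro m n
    have hm : (0 : ℝ) < (factors X m).ncard := by exact_mod_cast hpos m
    have hn : (0 : ℝ) < (factors X n).ncard := by exact_mod_cast hpos n
    have hmn : (0 : ℝ) < (factors X (m + n)).ncard := by exact_mod_cast hpos (m + n)
    rw [← Real.log_mul hm.ne' hn.ne']
    exact Real.log_le_log hmn (by exact_mod_cast factors_ncard_add_le X m n)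
  refine tendsto_nhds_limUnder ⟨_, hsub.tendsto_lim ⟨0, ?_⟩⟩
  rintro _ ⟨n, rfl⟩
  exact div_nonneg (Real.log_natCast_nonneg _) (Nat.cast_nonneg _)

/-- A (Büchi) automaton with state set `Q` over the alphabet `A`: transition relation
`trans ⊆ Q × A × Q`, initial states and final states. -/
structure Automaton (Q A : Type*) where
  trans : Set (Q × A × Q)
  init : Set Q
  final : Set Q

namespace Automaton

variable {Q A : Type*}

/-- `r 0, r 1, …, r n` is the sequence of states of a finite run labelled by the word
`w` of length `n`. -/
def IsRun (𝒜 : Automaton Q A) {n : ℕ} (w : Fin n → A) (r : Fin (n + 1) → Q) : Prop :=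
  ∀ i : Fin n, (r i.castSucc, w i, r i.succ) ∈ 𝒜.trans

/-- `r` is the sequence of states of an infinite run labelled by `x`. -/
def IsInfRun (𝒜 : Automaton Q A) (x : ℕ → A) (r : ℕ → Q) : Prop :=
  ∀ i : ℕ, (r i, x i, r (i + 1)) ∈ 𝒜.trans

/-- The set of accepted sequences: labels of infinite runs that start in an initial state and
visit final states infinitely often. -/
def accepted (𝒜 : Automaton Q A) : Set (ℕ → A) :=
  {x | ∃ r : ℕ → Q, 𝒜.IsInfRun x r ∧ r 0 ∈ 𝒜.init ∧ ∃ᶠ n in atTop, r n ∈ 𝒜.final}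

/-- From each state to each state there is a finite run. -/
def StronglyConnected (𝒜 : Automaton Q A) : Prop :=
  ∀ p q : Q, ∃ (n : ℕ) (w : Fin n → A) (r : Fin (n + 1) → Q),
    𝒜.IsRun w r ∧ r 0 = p ∧ r (Fin.last n) = q

/-- For all states `p, q` and each word `w` there is at most one run from `p` to `q`
labelled by `w`. -/
def Unambiguous (𝒜 : Automaton Q A) : Prop :=
  ∀ (p q : Q) (n : ℕ) (w : Fin n → A) (r s : Fin (n + 1) → Q),
    𝒜.IsRun w r → r 0 = p → r (Fin.last n) = q →
    𝒜.IsRun w s → s 0 = p → s (Fin.last n) = q → r = s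

/-- The adjacency matrix: its `(p, q)` entry is the number of transitions from `p` to `q`. -/
noncomputable def adjMatrix (𝒜 : Automaton Q A) : Matrix Q Q ℕ :=
  fun p q => {a : A | (p, a, q) ∈ 𝒜.trans}.ncard

/-- The spectral radius of the adjacency matrix: the largest modulus of its complex
eigenvalues. -/
noncomputable def spectralRad [Fintype Q] [DecidableEq Q] (𝒜 : Automaton Q A) : ℝ :=
  (spectralRadius ℂ (𝒜.adjMatrix.map (fun m : ℕ => (m : ℂ)))).toReal

end Automaton

/-- `X` is irreducible sofic: it is the set of sequences accepted by some (finite) strongly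
connected automaton (the state set is finite, so it may be taken in `Type`). -/
def IsIrreducibleSofic {A : Type*} (X : Set (ℕ → A)) : Prop :=
  ∃ (P : Type) (_ : Finite P) (ℬ : Automaton P A), ℬ.StronglyConnected ∧ ℬ.accepted = X

end SymbolicDynamicsAutomata

/-!
Up to constants, everything is a count of words. Replacing each transition of `𝒜` by a transition
labelled by itself gives `edgeAutomaton`, whose words are the runs of `𝒜`. The entries of the powers
of the adjacency matrix count these runs, so by Gelfand's formula the logarithm of the spectral
radius is the entropy of the edge automaton (`log_spectralRad`). The theorem thus compares three
entropies: of the runs of `𝒜`, of the labels of these runs (the entropy of the accepted shift), and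
of `X`. If `𝒜` is unambiguous, the first two agree, since a run is determined by its label and its
ends (`Unambiguous.entropy_edgeAutomaton`).

The two converse statements both follow from one gap lemma, `not_forall_exp_entropy_le`. In a strongly
connected automaton of entropy `h` the number of words of length `n` lies between `exp (h * n)` and
`K * exp (h * n)`; hence a prefix-closed set of words that can be left from every state has fewer
than `exp (h * n)` elements of some length `n`.

* Ambiguity (`unambiguous_of_entropy_eq`): in the edge automaton, take the lexicographically minimal
  runs with given label and ends. There are at least as many as labels, and if two distinct runs
  have the same label and ends, a run through the larger one is never minimal.
* Proper inclusion (`accepted_eq_of_entropy_eq`): in an automaton accepting `X`, take the labels of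
  the runs of `𝒜`. A factor of `X` that is not a factor of the shift accepted by `𝒜` leads out of
  them, and submultiplicativity bounds their number below by `exp (h * n)` if the entropies agree.
-/

namespace SymbolicDynamicsAutomata

/-! ### Growth rates, lexicographic order, shift spaces -/

/-- Sequences that agree up to a constant factor have the same exponential growth rate. -/
theorem tendsto_log_div_of_le {a b : ℕ → ℝ} {l C : ℝ} (ha : ∀ n, 0 < a n) (hb : ∀ n, 0 < b n)
    (hC : 0 < C) (hab : ∀ n, a n ≤ C * b n) (hba : ∀ n, b n ≤ C * a n)
    (h : Tendsto (fun n : ℕ => Real.log (a n) / n) atTop (𝓝 l)) :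
    Tendsto (fun n : ℕ => Real.log (b n) / n) atTop (𝓝 l) := by
  have h0 := tendsto_const_div_atTop_nhds_zero_nat (Real.log C)
  have h1 : Tendsto (fun n : ℕ => Real.log (a n) / n - Real.log C / n) atTop (𝓝 l) := by
    simpa using h.sub h0
  have h2 : Tendsto (fun n : ℕ => Real.log (a n) / n + Real.log C / n) atTop (𝓝 l) := by
    simpa using h.add h0
  refine tendsto_of_tendsto_of_tendsto_of_le_of_le h1 h2 (fun n => ?_) fun n => ?_
  · have := Real.log_le_log (ha n) (hab n)
    rw [Real.log_mul hC.ne' (hb n).ne'] at this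
    change Real.log (a n) / n - Real.log C / n ≤ Real.log (b n) / n
    rw [← sub_div]
    gcongr
    linarith
  · have := Real.log_le_log (hb n) (hba n)
    rw [Real.log_mul hC.ne' (ha n).ne'] at this
    change Real.log (b n) / n ≤ Real.log (a n) / n + Real.log C / n
    rw [← add_div]
    gcongr
    linarith

theorem lex_append_of_length_eq {E : Type*} {r : E → E → Prop} {a b : List E}
    (h : List.Lex r a b) (hlen : a.length = b.length) (c d : List E) :
    List.Lex r (a ++ c) (b ++ d) := by
  induction h with
  | nil => simp at hlen
  | rel h => exact .rel h
  | cons _ ih => exact .cons (ih (by simpa using hlen))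

/-- A sequence outside a shift space contains a factor that the shift space does not have. -/
theorem IsShiftSpace.exists_notMem_factors {A : Type*} [TopologicalSpace A] [DiscreteTopology A]
    {Y : Set (ℕ → A)} (hY : IsShiftSpace Y) {x : ℕ → A} (hx : x ∉ Y) :
    ∃ n, (fun i : Fin n => x i) ∉ factors Y n := by
  by_contra! hcon
  have hshift : ∀ y ∈ Y, ∀ k, (fun i => y (k + i)) ∈ Y := by
    intro y hy k
    induction k with
    | zero => simpa using hy
    | succ k ih =>
      rw [← hY.shift_image]
      refine ⟨_, ih, ?_⟩
      funext i
      simp only [shift]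
      congr 1
      omega
  choose y hy k hk using hcon
  refine hx (hY.isClosed.mem_of_tendsto (f := fun n i => y n (k n + i)) (b := atTop) ?_
    (Eventually.of_forall fun n => hshift _ (hy n) _))
  rw [tendsto_pi_nhds]
  intro i
  refine tendsto_nhds_of_eventually_eq ?_
  filter_upwards [eventually_gt_atTop i] with n hn
  exact (hk n ⟨i, hn⟩).symm

namespace Automaton

variable {Q A : Type*}

/-! ### Labels of finite runs -/

/-- `𝒜.Path p w q`: the word `w`, as a list, labels a finite run from `p` to `q`. -/
def Path (𝒜 : Automaton Q A) : Q → List A → Q → Prop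
  | p, [], q => p = q
  | p, a :: w, q => ∃ s, (p, a, s) ∈ 𝒜.trans ∧ Path 𝒜 s w q

/-- The words of length `n` that label a finite run from `t`. -/
def wordsFrom (𝒜 : Automaton Q A) (t : Q) (n : ℕ) : Set (List A) :=
  {w | w.length = n ∧ ∃ q, 𝒜.Path t w q}

/-- The words of length `n` that label a finite run between some two states. -/
def words (𝒜 : Automaton Q A) (n : ℕ) : Set (List A) :=
  {w | w.length = n ∧ ∃ p q, 𝒜.Path p w q}

theorem path_append {𝒜 : Automaton Q A} {p q : Q} {u v : List A} :
    𝒜.Path p (u ++ v) q ↔ ∃ s, 𝒜.Path p u s ∧ 𝒜.Path s v q := by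
  induction u generalizing p with
  | nil => simp [Path]
  | cons a u ih =>
    simp only [List.cons_append, Path, ih]
    constructor
    · rintro ⟨s, hs, t, h1, h2⟩
      exact ⟨t, ⟨s, hs, h1⟩, h2⟩
    · rintro ⟨t, ⟨s, hs, h1⟩, h2⟩
      exact ⟨s, hs, t, h1, h2⟩

theorem IsRun.path {𝒜 : Automaton Q A} {n : ℕ} {w : Fin n → A} {r : Fin (n + 1) → Q}
    (h : 𝒜.IsRun w r) : 𝒜.Path (r 0) (List.ofFn w) (r (Fin.last n)) := by
  induction n with
  | zero => simp [Path]
  | succ n ih =>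
    rw [List.ofFn_succ]
    refine ⟨r 1, h 0, ?_⟩
    exact ih (w := fun i => w i.succ) (r := fun i => r i.succ) fun i => h i.succ

theorem Path.exists_isRun {𝒜 : Automaton Q A} {n : ℕ} {w : Fin n → A} {p q : Q}
    (h : 𝒜.Path p (List.ofFn w) q) :
    ∃ r : Fin (n + 1) → Q, 𝒜.IsRun w r ∧ r 0 = p ∧ r (Fin.last n) = q := by
  induction n generalizing p with
  | zero =>
    simp only [List.ofFn_zero, Path] at h
    exact ⟨fun _ => p, fun i => i.elim0, rfl, h⟩
  | succ n ih =>
    rw [List.ofFn_succ] at h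
    obtain ⟨s, hs, h⟩ := h
    obtain ⟨r, hr, h0, h1⟩ := ih h
    refine ⟨Fin.cons p r, fun i => ?_, rfl, ?_⟩
    · refine Fin.cases ?_ (fun j => ?_) i
      · simpa [h0] using hs
      · simpa using hr j
    · rw [← Fin.succ_last, Fin.cons_succ, h1]

theorem StronglyConnected.exists_path {𝒜 : Automaton Q A} (h : 𝒜.StronglyConnected) (p q : Q) :
    ∃ w, 𝒜.Path p w q := by
  obtain ⟨n, w, r, hr, rfl, rfl⟩ := h p q
  exact ⟨_, hr.path⟩

theorem IsInfRun.path {𝒜 : Automaton Q A} {x : ℕ → A} {r : ℕ → Q} (h : 𝒜.IsInfRun x r)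
    (k n : ℕ) : 𝒜.Path (r k) (List.ofFn fun i : Fin n => x (k + i)) (r (k + n)) :=
  IsRun.path (r := fun i : Fin (n + 1) => r (k + i)) fun i => h (k + i)

/-- A finite run ending where a Büchi-successful infinite run starts can be put in front of it. -/
theorem Path.prepend {𝒜 : Automaton Q A} {p q : Q} {w : List A} (h : 𝒜.Path p w q)
    {x : ℕ → A} {r : ℕ → Q} (hr : 𝒜.IsInfRun x r) (h0 : r 0 = q)
    (hf : ∃ᶠ n in atTop, r n ∈ 𝒜.final) :
    ∃ (y : ℕ → A) (s : ℕ → Q), 𝒜.IsInfRun y s ∧ s 0 = p ∧ (∃ᶠ n in atTop, s n ∈ 𝒜.final) ∧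
      (List.ofFn fun i : Fin w.length => y i) = w ∧ ∀ i, y (w.length + i) = x i := by
  induction w generalizing p with
  | nil => exact ⟨x, r, hr, h0.trans h.symm, hf, by simp, by simp⟩
  | cons a w ih =>
    obtain ⟨t, ht, h⟩ := h
    obtain ⟨y, s, h1, h2, h3, h4, h5⟩ := ih h
    refine ⟨fun i => Nat.casesOn i a y, fun i => Nat.casesOn i p s, ?_, rfl, ?_, ?_, ?_⟩
    · rintro (_ | i)
      · simpa [h2] using ht
      · exact h1 i
    · rw [frequently_atTop] at h3 ⊢
      intro k
      obtain ⟨b, hb, hb'⟩ := h3 k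
      exact ⟨b + 1, by omega, hb'⟩
    · simpa [List.ofFn_succ] using h4
    · intro i
      have := h5 i
      rw [List.length_cons, Nat.add_right_comm]
      exact this

theorem exists_infRun_from {𝒜 : Automaton Q A} (hc : 𝒜.StronglyConnected)
    (hne : 𝒜.accepted.Nonempty) (t : Q) :
    ∃ (x : ℕ → A) (r : ℕ → Q), 𝒜.IsInfRun x r ∧ r 0 = t ∧ ∃ᶠ n in atTop, r n ∈ 𝒜.final := by
  obtain ⟨x, r, hr, -, hf⟩ := hne
  obtain ⟨w, hw⟩ := hc.exists_path t (r 0)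
  obtain ⟨y, s, h1, h2, h3, -⟩ := hw.prepend hr rfl hf
  exact ⟨y, s, h1, h2, h3⟩

/-- The factors of the accepted sequences are the labels of all finite runs. -/
theorem mem_factors_accepted {𝒜 : Automaton Q A} (hc : 𝒜.StronglyConnected)
    (hne : 𝒜.accepted.Nonempty) {n : ℕ} {w : Fin n → A} :
    w ∈ factors 𝒜.accepted n ↔ List.ofFn w ∈ 𝒜.words n := by
  constructor
  · rintro ⟨x, ⟨r, hr, -, -⟩, k, hk⟩
    rw [funext hk]
    exact ⟨by simp, _, _, hr.path k n⟩
  · rintro ⟨-, p, q, hw⟩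
    obtain ⟨x, r, hr, h0, hf⟩ := exists_infRun_from hc hne q
    obtain ⟨z, ρ, -, hi, -⟩ := hne
    obtain ⟨y, s, h1, h2, h3, h4, -⟩ := hw.prepend hr h0 hf
    obtain ⟨u, hu⟩ := hc.exists_path (ρ 0) p
    obtain ⟨y', s', h1', h2', h3', -, h5'⟩ := hu.prepend h1 h2 h3
    refine ⟨y', ⟨s', h1', h2' ▸ hi, h3'⟩, u.length, fun i => ?_⟩
    rw [h5']
    have := congrArg (fun l => l[(i : ℕ)]?) h4
    simpa using this.symm

theorem finite_words [Finite A] (𝒜 : Automaton Q A) (n : ℕ) : (𝒜.words n).Finite :=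
  (List.finite_length_eq A n).subset fun _ h => h.1

theorem finite_wordsFrom [Finite A] (𝒜 : Automaton Q A) (t : Q) (n : ℕ) :
    (𝒜.wordsFrom t n).Finite :=
  (List.finite_length_eq A n).subset fun _ h => h.1

theorem ncard_factors_accepted {𝒜 : Automaton Q A} (hc : 𝒜.StronglyConnected)
    (hne : 𝒜.accepted.Nonempty) (n : ℕ) :
    (factors 𝒜.accepted n).ncard = (𝒜.words n).ncard := by
  rw [← Set.ncard_image_of_injective _ (List.ofFn_injective (n := n))]
  congr 1
  ext l
  constructor
  · rintro ⟨w, hw, rfl⟩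
    exact (mem_factors_accepted hc hne).1 hw
  · intro hl
    obtain ⟨rfl, -⟩ := id hl
    exact ⟨l.get, (mem_factors_accepted hc hne).2 (by simpa using hl), by simp⟩

theorem ncard_words_pos [Finite A] {𝒜 : Automaton Q A} (hc : 𝒜.StronglyConnected)
    (hne : 𝒜.accepted.Nonempty) (n : ℕ) : 0 < (𝒜.words n).ncard := by
  rw [← ncard_factors_accepted hc hne]
  exact (Set.ncard_pos (Set.toFinite _)).2 (factors_nonempty hne n)

theorem tendsto_log_words [Finite A] {𝒜 : Automaton Q A} (hc : 𝒜.StronglyConnected)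
    (hne : 𝒜.accepted.Nonempty) :
    Tendsto (fun n : ℕ => Real.log ((𝒜.words n).ncard : ℝ) / n) atTop
      (𝓝 (entropy 𝒜.accepted)) := by
  simpa only [ncard_factors_accepted hc hne] using tendsto_entropy hne

theorem exists_path_length {𝒜 : Automaton Q A} (hc : 𝒜.StronglyConnected)
    (hne : 𝒜.accepted.Nonempty) (t : Q) (n : ℕ) : ∃ v q, v.length = n ∧ 𝒜.Path t v q := by
  obtain ⟨x, r, hr, rfl, -⟩ := exists_infRun_from hc hne t
  exact ⟨_, _, by simp, hr.path 0 n⟩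

/-! ### Growth of the number of labels -/

/-- All states of a strongly connected automaton have comparable numbers of words of length `n`:
a run from `t'` becomes one from `t` after prefixing a fixed run from `t` to `t'`, and the prefix
of length `n` of the result loses only boundedly many letters. -/
theorem exists_ncard_words_le [Finite Q] [Finite A] {𝒜 : Automaton Q A}
    (hc : 𝒜.StronglyConnected) :
    ∃ K : ℕ, ∀ t n, (𝒜.words n).ncard ≤ K * (𝒜.wordsFrom t n).ncard := by
  classical
  have := Fintype.ofFinite Q
  choose b hb using hc.exists_path
  have key : ∀ t t' n, (𝒜.wordsFrom t' n).ncard ≤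
      {l : List A | l.length = (b t t').length}.ncard * (𝒜.wordsFrom t n).ncard := by
    intro t t' n
    rw [← Set.ncard_prod]
    refine Set.ncard_le_ncard_of_injOn
      (fun w => ((b t t' ++ w).drop n, (b t t' ++ w).take n)) ?_ ?_
      ((List.finite_length_eq A _).prod (𝒜.finite_wordsFrom t n))
    · rintro w ⟨hw, q, hq⟩
      refine ⟨by simp [hw], by simp [hw], ?_⟩
      have : 𝒜.Path t (b t t' ++ w) q := path_append.2 ⟨t', hb t t', hq⟩
      rw [← List.take_append_drop n (b t t' ++ w)] at this
      obtain ⟨s, hs, -⟩ := path_append.1 this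
      exact ⟨s, hs⟩
    · intro v _ w _ h
      simp only [Prod.mk.injEq] at h
      have : b t t' ++ v = b t t' ++ w := by
        rw [← List.take_append_drop n (b t t' ++ v), h.1, h.2, List.take_append_drop]
      exact List.append_cancel_left this
  refine ⟨∑ t, ∑ t', {l : List A | l.length = (b t t').length}.ncard, fun t n => ?_⟩
  have hU : 𝒜.words n = ⋃ t', 𝒜.wordsFrom t' n := by
    ext w
    simp [words, wordsFrom]
  calc (𝒜.words n).ncard ≤ ∑ t', (𝒜.wordsFrom t' n).ncard := by
        rw [hU]
        simpa using Set.ncard_iUnion_le_of_fintype (fun t' => 𝒜.wordsFrom t' n)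
    _ ≤ ∑ t', {l : List A | l.length = (b t t').length}.ncard * (𝒜.wordsFrom t n).ncard :=
        Finset.sum_le_sum fun t' _ => key t t' n
    _ = (∑ t', {l : List A | l.length = (b t t').length}.ncard) * (𝒜.wordsFrom t n).ncard := by
        rw [Finset.sum_mul]
    _ ≤ _ := by
        refine Nat.mul_le_mul_right _ ?_
        exact Finset.single_le_sum
          (f := fun t => ∑ t', {l : List A | l.length = (b t t').length}.ncard)
          (fun _ _ => Nat.zero_le _) (Finset.mem_univ t)

/-- Each word in a set `S` of labels of length `m` has, up to the constant of
`exists_ncard_words_le`, as many continuations of length `n` as there are words of length `n`. -/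
theorem ncard_mul_words_le [Finite A] {𝒜 : Automaton Q A} {K : ℕ}
    (hK : ∀ t n, (𝒜.words n).ncard ≤ K * (𝒜.wordsFrom t n).ncard) {m : ℕ} {S : Set (List A)}
    (hS : S ⊆ 𝒜.words m) (n : ℕ) :
    S.ncard * (𝒜.words n).ncard ≤ K * {z ∈ 𝒜.words (m + n) | z.take m ∈ S}.ncard := by
  classical
  have hSf : S.Finite := (𝒜.finite_words m).subset hS
  have hZf : {z ∈ 𝒜.words (m + n) | z.take m ∈ S}.Finite :=
    (𝒜.finite_words _).subset fun _ h => h.1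
  have hfib := Finset.card_eq_sum_card_fiberwise (s := hZf.toFinset) (t := hSf.toFinset)
    (f := fun z => z.take m) (by intro z hz; simp at hz ⊢; exact hz.2)
  rw [Set.ncard_eq_toFinset_card _ hSf, Set.ncard_eq_toFinset_card _ hZf, hfib, Finset.mul_sum,
    ← smul_eq_mul]
  refine Finset.card_nsmul_le_sum _ _ _ fun s hs => ?_
  rw [Set.Finite.mem_toFinset] at hs
  obtain ⟨hlen, p, t, hp⟩ := hS hs
  refine (hK t n).trans (Nat.mul_le_mul_left K ?_)
  rw [← Set.ncard_coe_finset]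
  refine Set.ncard_le_ncard_of_injOn (fun v => s ++ v) ?_
    (fun _ _ _ _ h => List.append_cancel_left h) (Finset.finite_toSet _)
  rintro v ⟨hv, q, hq⟩
  have : (s ++ v).take m = s := by rw [← hlen]; simp
  simp only [Finset.coe_filter, Set.Finite.mem_toFinset, Set.mem_ofPred_eq, this]
  exact ⟨⟨⟨by simp [hlen, hv], p, q, path_append.2 ⟨t, hp, hq⟩⟩, hs⟩, trivial⟩

/-- The lower bound given by submultiplicativity: the entropy is an infimum. -/
theorem exp_entropy_le_ncard_words [Finite A] {𝒜 : Automaton Q A} (hc : 𝒜.StronglyConnected)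
    (hne : 𝒜.accepted.Nonempty) (n : ℕ) :
    Real.exp (entropy 𝒜.accepted * n) ≤ (𝒜.words n).ncard := by
  have hpos : ∀ n, (0 : ℝ) < (𝒜.words n).ncard := fun n => by
    exact_mod_cast ncard_words_pos hc hne n
  have hsub : Subadditive (fun n : ℕ => Real.log ((𝒜.words n).ncard : ℝ)) := by
    intro m n
    rw [← Real.log_mul (hpos m).ne' (hpos n).ne']
    refine Real.log_le_log (hpos _) ?_
    simp only [← ncard_factors_accepted hc hne]
    exact_mod_cast factors_ncard_add_le _ m n
  have hbdd := (tendsto_log_words hc hne).bddBelow_range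
  have hlim := tendsto_nhds_unique (hsub.tendsto_lim hbdd) (tendsto_log_words hc hne)
  rcases Nat.eq_zero_or_pos n with rfl | hn
  · simpa using Nat.one_le_iff_ne_zero.2 (ncard_words_pos hc hne 0).ne'
  · have := hsub.lim_le_div hbdd hn.ne'
    rw [hlim, le_div_iff₀ (by exact_mod_cast hn)] at this
    rw [← Real.exp_log (hpos n)]
    exact Real.exp_le_exp.2 this

/-- The matching upper bound, from supermultiplicativity up to the constant `K`. -/
theorem ncard_words_le_exp_entropy [Finite A] {𝒜 : Automaton Q A} (hc : 𝒜.StronglyConnected)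
    (hne : 𝒜.accepted.Nonempty) {K : ℕ}
    (hK : ∀ t n, (𝒜.words n).ncard ≤ K * (𝒜.wordsFrom t n).ncard) (n : ℕ) :
    ((𝒜.words n).ncard : ℝ) ≤ K * Real.exp (entropy 𝒜.accepted * n) := by
  have hpos : ∀ n, (0 : ℝ) < (𝒜.words n).ncard := fun n => by
    exact_mod_cast ncard_words_pos hc hne n
  have hmul : ∀ m n, (𝒜.words m).ncard * (𝒜.words n).ncard ≤ K * (𝒜.words (m + n)).ncard :=
    fun m n => (ncard_mul_words_le hK subset_rfl n).trans
      (Nat.mul_le_mul_left K (Set.ncard_le_ncard (fun _ h => h.1) (𝒜.finite_words _)))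
  have hK0 : (0 : ℝ) < K := by
    have h1 := hmul 0 0
    have h2 := ncard_words_pos hc hne 0
    have : 0 < K := Nat.pos_of_ne_zero fun h => by
      rw [h, Nat.zero_mul] at h1
      exact absurd h1 (by have := Nat.mul_pos h2 h2; omega)
    exact_mod_cast this
  have hsub : Subadditive
      (fun n : ℕ => Real.log K - Real.log ((𝒜.words n).ncard : ℝ)) := by
    intro m n
    have : Real.log ((𝒜.words m).ncard * (𝒜.words n).ncard : ℝ) ≤
        Real.log (K * (𝒜.words (m + n)).ncard : ℝ) :=
      Real.log_le_log (mul_pos (hpos m) (hpos n)) (by exact_mod_cast hmul m n)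
    rw [Real.log_mul (hpos m).ne' (hpos n).ne', Real.log_mul hK0.ne' (hpos _).ne'] at this
    linarith
  have ht : Tendsto (fun n : ℕ => (Real.log K - Real.log ((𝒜.words n).ncard : ℝ)) / n) atTop
      (𝓝 (-entropy 𝒜.accepted)) := by
    have := (tendsto_const_div_atTop_nhds_zero_nat (Real.log K)).sub (tendsto_log_words hc hne)
    simpa [sub_div] using this
  have hlim := tendsto_nhds_unique (hsub.tendsto_lim ht.bddBelow_range) ht
  rcases Nat.eq_zero_or_pos n with rfl | hn
  · have h1 := hmul 0 0
    have : (𝒜.words 0).ncard ≤ K := by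
      have := ncard_words_pos hc hne 0
      exact Nat.le_of_mul_le_mul_right h1 this
    simpa using this
  · have := hsub.lim_le_div ht.bddBelow_range hn.ne'
    rw [hlim, le_div_iff₀ (by exact_mod_cast hn)] at this
    rw [← Real.exp_log (hpos n), ← Real.exp_log hK0, ← Real.exp_add, Real.exp_le_exp]
    linarith

/-- **Entropy gap.** Let `W` be a prefix-closed set of labels such that from every state some word
leads out of `W` for good. Then `W` has fewer than `exp (h * n)` words of some length `n`, where `h`
is the entropy of the automaton. Otherwise, with `L` bounding the lengths of the words leading out,
sorting the words of length `L * (k + 1)` by the block of length `L` in which they leave `W` gives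
`k + 1` disjoint sets, each of size at least a constant times `exp (h * L * (k + 1))`, the order of
the total number of words. -/
theorem not_forall_exp_entropy_le [Finite Q] [Finite A] {𝒜 : Automaton Q A}
    (hc : 𝒜.StronglyConnected) (hne : 𝒜.accepted.Nonempty) {W : Set (List A)}
    (hpre : ∀ u v, u ++ v ∈ W → u ∈ W) (hW : ∀ w ∈ W, ∃ p q, 𝒜.Path p w q)
    (hext : ∀ t, ∃ b q, 𝒜.Path t b q ∧ ∀ w, w ++ b ∉ W) :
    ¬ ∀ n : ℕ, Real.exp (entropy 𝒜.accepted * n) ≤ {w ∈ W | w.length = n}.ncard := by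
  classical
  intro hlow
  have := Fintype.ofFinite Q
  obtain ⟨K, hK⟩ := exists_ncard_words_le hc
  set h := entropy 𝒜.accepted with hh
  choose b e hb hbW using hext
  set L := ∑ t, (b t).length with hL
  -- all the extensions can be padded to the common length `L`
  have hext' : ∀ w ∈ W, ∃ v, v.length = L ∧ w ++ v ∉ W ∧ ∃ p q, 𝒜.Path p (w ++ v) q := by
    intro w hw
    obtain ⟨p, t, hp⟩ := hW w hw
    obtain ⟨v, q, hv, hq⟩ := exists_path_length hc hne (e t) (L - (b t).length)
    have hle : (b t).length ≤ L :=
      Finset.single_le_sum (f := fun t => (b t).length) (fun _ _ => Nat.zero_le _)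
        (Finset.mem_univ t)
    refine ⟨b t ++ v, by simp [hv, hle], fun hmem => ?_, p, q, ?_⟩
    · rw [← List.append_assoc] at hmem
      exact hbW t w (hpre _ _ hmem)
    · exact path_append.2 ⟨t, hp, path_append.2 ⟨e t, hb t, hq⟩⟩
  choose! v hvL hvW hvP using hext'
  have hfinW : ∀ n, {w ∈ W | w.length = n}.Finite := fun n =>
    (List.finite_length_eq A n).subset fun _ h => h.2
  have key : ∀ k : ℕ, (k + 1 : ℝ) ≤ K * (K * Real.exp (h * L)) := by
    intro k
    let Z : ℕ → Set (List A) := fun i =>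
      {z ∈ 𝒜.words (L * (k + 1)) | z.take (L * i) ∈ W ∧ z.take (L * (i + 1)) ∉ W}
    have hZf : ∀ i, (Z i).Finite := fun i => (𝒜.finite_words _).subset fun _ h => h.1
    have hmono : ∀ {z : List A} {m n : ℕ}, m ≤ n → z.take n ∈ W → z.take m ∈ W := by
      intro z m n hmn hz
      refine hpre (z.take m) ((z.take n).drop m) ?_
      have : (z.take n).take m = z.take m := by rw [List.take_take, min_eq_left hmn]
      rwa [← this, List.take_append_drop]
    -- the sets `Z i` are disjoint, since `i` is the last index with `z.take (L * i) ∈ W`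
    have hdisj : ∑ i ∈ Finset.range (k + 1), (Z i).ncard ≤ (𝒜.words (L * (k + 1))).ncard := by
      have hlt : ∀ {i j z}, i < j → z ∈ Z i → z ∉ Z j := fun {i j z} hij hi hj =>
        hi.2.2 (hmono (Nat.mul_le_mul_left L hij) hj.2.1)
      simp only [fun i => Set.ncard_eq_toFinset_card _ (hZf i)]
      rw [← Finset.card_biUnion, Set.ncard_eq_toFinset_card _ (𝒜.finite_words _)]
      · refine Finset.card_le_card fun z hz => ?_
        simp only [Finset.mem_biUnion, Set.Finite.mem_toFinset] at hz ⊢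
        obtain ⟨i, -, hz⟩ := hz
        exact hz.1
      · intro i _ j _ hij
        rw [Function.onFun, Finset.disjoint_left]
        intro z hi hj
        rw [Set.Finite.mem_toFinset] at hi hj
        rcases lt_or_gt_of_ne hij with h | h
        · exact hlt h hi hj
        · exact hlt h hj hi
    have hterm : ∀ i ∈ Finset.range (k + 1), Real.exp (h * (L * k : ℕ)) ≤ K * (Z i).ncard := by
      intro i hi
      have hik : i ≤ k := by simpa [Nat.lt_succ_iff] using hi
      let S : Set (List A) := {z ∈ 𝒜.words (L * (i + 1)) | z.take (L * i) ∈ W ∧ z ∉ W}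
      have hS : {w ∈ W | w.length = L * i}.ncard ≤ S.ncard := by
        refine Set.ncard_le_ncard_of_injOn (fun w => w ++ v w) ?_ ?_
          ((𝒜.finite_words _).subset fun _ h => h.1)
        · rintro w ⟨hw, hlen⟩
          refine ⟨⟨by simp [hvL w hw, hlen, Nat.mul_succ], hvP w hw⟩, ?_, hvW w hw⟩
          rw [← hlen]
          simpa using hw
        · rintro w ⟨hw, hlen⟩ w' ⟨hw', hlen'⟩ heq
          exact (List.append_inj heq (hlen.trans hlen'.symm)).1
      have hsum : L * (i + 1) + L * (k - i) = L * (k + 1) := by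
        rw [← Nat.mul_add]
        congr 1
        omega
      have hSZ := ncard_mul_words_le hK (S := S) (fun _ h => h.1) (L * (k - i))
      rw [hsum] at hSZ
      have hZ : {z ∈ 𝒜.words (L * (k + 1)) | z.take (L * (i + 1)) ∈ S}.ncard ≤ (Z i).ncard := by
        refine Set.ncard_le_ncard ?_ (hZf i)
        rintro z ⟨hz, -, h1, h2⟩
        refine ⟨hz, ?_, h2⟩
        rwa [List.take_take, min_eq_left (Nat.mul_le_mul_left L (Nat.le_succ i))] at h1
      have hexp : Real.exp (h * (L * k : ℕ)) =
          Real.exp (h * (L * i : ℕ)) * Real.exp (h * (L * (k - i) : ℕ)) := by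
        rw [← Real.exp_add, ← mul_add, ← Nat.cast_add, ← Nat.mul_add, Nat.add_sub_cancel' hik]
      calc Real.exp (h * (L * k : ℕ))
          ≤ ({w ∈ W | w.length = L * i}.ncard : ℝ) * (𝒜.words (L * (k - i))).ncard := by
            rw [hexp]
            exact mul_le_mul (hlow _) (exp_entropy_le_ncard_words hc hne _) (Real.exp_nonneg _)
              (Nat.cast_nonneg _)
        _ ≤ (S.ncard : ℝ) * (𝒜.words (L * (k - i))).ncard := by gcongr
        _ ≤ K * (Z i).ncard := by exact_mod_cast hSZ.trans (Nat.mul_le_mul_left K hZ)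
    have hsum := Finset.sum_le_sum hterm
    rw [Finset.sum_const, Finset.card_range, nsmul_eq_mul, ← Finset.mul_sum] at hsum
    have hfin : ((k + 1 : ℕ) : ℝ) * Real.exp (h * (L * k : ℕ)) ≤
        K * (K * Real.exp (h * L)) * Real.exp (h * (L * k : ℕ)) := by
      refine hsum.trans ?_
      rw [mul_assoc, mul_assoc, ← Real.exp_add]
      refine mul_le_mul_of_nonneg_left ?_ (Nat.cast_nonneg _)
      have hup := ncard_words_le_exp_entropy hc hne hK (L * (k + 1))
      have heq : h * L + h * (L * k : ℕ) = h * (L * (k + 1) : ℕ) := by push_cast; ring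
      rw [heq]
      refine le_trans ?_ hup
      exact_mod_cast hdisj
    exact_mod_cast le_of_mul_le_mul_right hfin (Real.exp_pos _)
  obtain ⟨k, hk⟩ := exists_nat_gt ((K : ℝ) * (K * Real.exp (h * L)))
  linarith [key k]

/-! ### Runs as lists of transitions -/

/-- The automaton of transitions of `𝒜`: each transition is labelled by itself, so that the words
of this automaton are the runs of `𝒜`, as lists of transitions. -/
def edgeAutomaton (𝒜 : Automaton Q A) : Automaton Q (Q × A × Q) where
  trans := {t | t.2.1 ∈ 𝒜.trans ∧ t.2.1.1 = t.1 ∧ t.2.1.2.2 = t.2.2}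
  init := 𝒜.init
  final := 𝒜.final

/-- The label of a run given as a list of transitions. -/
def label (e : List (Q × A × Q)) : List A := e.map fun t => t.2.1

theorem length_label (e : List (Q × A × Q)) : (label e).length = e.length := by simp [label]

theorem label_append (e f : List (Q × A × Q)) : label (e ++ f) = label e ++ label f := by
  simp [label]

variable {𝒜 : Automaton Q A}

theorem Path.label {p q : Q} {e : List (Q × A × Q)} (h : 𝒜.edgeAutomaton.Path p e q) :
    𝒜.Path p (label e) q := by
  induction e generalizing p with
  | nil => exact h
  | cons t e ih =>
    obtain ⟨s, ⟨h1, h2, h3⟩, h⟩ := h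
    obtain ⟨p', a, s'⟩ := t
    obtain rfl : p' = p := h2
    obtain rfl : s' = s := h3
    exact ⟨s', h1, ih h⟩

theorem Path.exists_edge {p q : Q} {w : List A} (h : 𝒜.Path p w q) :
    ∃ e, Automaton.label e = w ∧ 𝒜.edgeAutomaton.Path p e q := by
  induction w generalizing p with
  | nil => exact ⟨[], rfl, h⟩
  | cons a w ih =>
    obtain ⟨s, hs, h⟩ := h
    obtain ⟨e, rfl, he⟩ := ih h
    exact ⟨(p, a, s) :: e, rfl, s, ⟨hs, rfl, rfl⟩, he⟩

theorem Path.start_eq {p p' q q' : Q} {e : List (Q × A × Q)} (he : e ≠ [])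
    (h : 𝒜.edgeAutomaton.Path p e q) (h' : 𝒜.edgeAutomaton.Path p' e q') : p = p' := by
  cases e with
  | nil => exact absurd rfl he
  | cons t e =>
    obtain ⟨s, ⟨-, h2, -⟩, -⟩ := h
    obtain ⟨s', ⟨-, h2', -⟩, -⟩ := h'
    exact h2.symm.trans h2'

theorem Path.end_eq {p q q' : Q} {e : List (Q × A × Q)}
    (h : 𝒜.edgeAutomaton.Path p e q) (h' : 𝒜.edgeAutomaton.Path p e q') : q = q' := by
  induction e generalizing p with
  | nil => exact h.symm.trans h'
  | cons t e ih =>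
    obtain ⟨s, ⟨-, -, h2⟩, h⟩ := h
    obtain ⟨s', ⟨-, -, h2'⟩, h'⟩ := h'
    obtain rfl : s = s' := h2.symm.trans h2'
    exact ih h h'

theorem stronglyConnected_edgeAutomaton (hc : 𝒜.StronglyConnected) :
    𝒜.edgeAutomaton.StronglyConnected := by
  intro p q
  obtain ⟨w, hw⟩ := hc.exists_path p q
  obtain ⟨e, -, he⟩ := hw.exists_edge
  rw [← List.ofFn_get e] at he
  exact ⟨_, _, he.exists_isRun⟩

theorem accepted_edgeAutomaton_nonempty (hne : 𝒜.accepted.Nonempty) :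
    𝒜.edgeAutomaton.accepted.Nonempty := by
  obtain ⟨x, r, hr, hi, hf⟩ := hne
  exact ⟨fun i => (r i, x i, r (i + 1)), r, fun i => ⟨hr i, rfl, rfl⟩, hi, hf⟩

/-- Unambiguity in terms of runs as lists of transitions. -/
theorem unambiguous_iff : 𝒜.Unambiguous ↔ ∀ (p q : Q) (e f : List (Q × A × Q)),
    𝒜.edgeAutomaton.Path p e q → 𝒜.edgeAutomaton.Path p f q → label e = label f → e = f := by
  constructor
  · intro hU p q e f he hf hef
    have hlen : e.length = f.length := by rw [← length_label e, hef, length_label]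
    obtain ⟨n, e', rfl⟩ : ∃ (n : ℕ) (e' : Fin n → Q × A × Q), e = List.ofFn e' :=
      ⟨_, _, (List.ofFn_get e).symm⟩
    obtain ⟨f', rfl⟩ : ∃ f' : Fin n → Q × A × Q, f = List.ofFn f' := by
      obtain rfl : n = f.length := by simpa using hlen
      exact ⟨_, (List.ofFn_get f).symm⟩
    simp only [label, List.map_ofFn, List.ofFn_inj] at hef
    obtain ⟨r, hr, hr0, hr1⟩ := he.exists_isRun
    obtain ⟨s, hs, hs0, hs1⟩ := hf.exists_isRun
    have aux : ∀ {g : Fin n → Q × A × Q} {t : Fin (n + 1) → Q}, 𝒜.edgeAutomaton.IsRun g t →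
        ∀ i, g i = (t i.castSucc, (g i).2.1, t i.succ) := fun h i =>
      Prod.ext (h i).2.1 (Prod.ext rfl (h i).2.2)
    have hrun : ∀ {g : Fin n → Q × A × Q} {t : Fin (n + 1) → Q}, 𝒜.edgeAutomaton.IsRun g t →
        𝒜.IsRun (fun i => (g i).2.1) t := fun {g t} h i => by
      rw [← aux h i]
      exact (h i).1
    have hw : (fun i => (e' i).2.1) = fun i => (f' i).2.1 := hef
    have hrs := hU p q n _ r s (hrun hr) hr0 hr1 (hw ▸ hrun hs) hs0 hs1
    congr 1
    funext i
    rw [aux hr i, aux hs i, hrs, congrFun hw i]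
  · intro h p q n w r s hr hr0 hr1 hs hs0 hs1
    have hrun : ∀ {t : Fin (n + 1) → Q}, 𝒜.IsRun w t →
        𝒜.edgeAutomaton.IsRun (fun i => (t i.castSucc, w i, t i.succ)) t := fun h i =>
      ⟨h i, rfl, rfl⟩
    have hr' := (hrun hr).path
    have hs' := (hrun hs).path
    rw [hr0, hr1] at hr'
    rw [hs0, hs1] at hs'
    have heq := List.ofFn_injective (h p q _ _ hr' hs' (by simp [label, Function.comp_def]))
    funext i
    refine Fin.lastCases (hr1.trans hs1.symm) (fun j => ?_) i
    exact congrArg Prod.fst (congrFun heq j)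

/-! ### Spectral radius and growth of the number of runs -/

/-- The entries of the powers of the adjacency matrix count the runs. -/
theorem adjMatrix_pow_apply [Fintype Q] [DecidableEq Q] [Finite A] (𝒜 : Automaton Q A) (n : ℕ)
    (p q : Q) : (𝒜.adjMatrix ^ n) p q =
      {e : List (Q × A × Q) | e.length = n ∧ 𝒜.edgeAutomaton.Path p e q}.ncard := by
  induction n generalizing p with
  | zero =>
    rw [pow_zero, Matrix.one_apply]
    split_ifs with h
    · subst h
      rw [eq_comm, Set.ncard_eq_one]
      refine ⟨[], ?_⟩
      ext e
      simp only [List.length_eq_zero_iff, Set.mem_ofPred_eq, Set.mem_singleton_iff]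
      exact ⟨fun h => h.1, fun h => ⟨h, h ▸ rfl⟩⟩
    · rw [eq_comm, Set.ncard_eq_zero ((List.finite_length_eq _ 0).subset fun _ h => h.1),
        Set.eq_empty_iff_forall_notMem]
      rintro e ⟨he, hp⟩
      rw [List.length_eq_zero_iff] at he
      subst he
      exact h hp
  | succ n ih =>
    have hfin : ∀ s, Finite {e : List (Q × A × Q) // e.length = n ∧
        𝒜.edgeAutomaton.Path s e q} := fun s =>
      ((List.finite_length_eq _ n).subset (fun _ h => h.1) :
        {e : List (Q × A × Q) | e.length = n ∧ 𝒜.edgeAutomaton.Path s e q}.Finite).to_subtype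
    let f : (Σ s : Q, {a : A // (p, a, s) ∈ 𝒜.trans} ×
        {e : List (Q × A × Q) // e.length = n ∧ 𝒜.edgeAutomaton.Path s e q}) →
        {e : List (Q × A × Q) // e.length = n + 1 ∧ 𝒜.edgeAutomaton.Path p e q} := fun x =>
      ⟨(p, x.2.1.1, x.1) :: x.2.2.1, by simp [x.2.2.2.1], x.1, ⟨x.2.1.2, rfl, rfl⟩, x.2.2.2.2⟩
    have hf : Function.Bijective f := by
      constructor
      · rintro ⟨s, ⟨a, ha⟩, ⟨e, he⟩⟩ ⟨s', ⟨a', ha'⟩, ⟨e', he'⟩⟩ h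
        simp only [f, Subtype.mk.injEq, List.cons.injEq, Prod.mk.injEq] at h
        obtain ⟨⟨-, rfl, rfl⟩, rfl⟩ := h
        rfl
      · rintro ⟨_ | ⟨⟨p', a, s'⟩, e⟩, hlen, hp⟩
        · simp at hlen
        · obtain ⟨s, ⟨h1, h2, h3⟩, h⟩ := hp
          obtain rfl : p' = p := h2
          obtain rfl : s' = s := h3
          exact ⟨⟨s', ⟨a, h1⟩, ⟨e, by simpa using hlen, h⟩⟩, rfl⟩
    have hcard := Nat.card_congr (Equiv.ofBijective f hf)
    rw [Nat.card_sigma] at hcard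
    rw [pow_succ', Matrix.mul_apply]
    refine Eq.trans (Finset.sum_congr rfl fun s _ => ?_) hcard
    rw [ih s, Nat.card_prod]
    rfl

theorem adjMatrix_pow_apply_le_ncard_words [Fintype Q] [DecidableEq Q] [Finite A]
    (𝒜 : Automaton Q A) (n : ℕ) (p q : Q) :
    (𝒜.adjMatrix ^ n) p q ≤ (𝒜.edgeAutomaton.words n).ncard := by
  rw [adjMatrix_pow_apply]
  exact Set.ncard_le_ncard (fun e h => ⟨h.1, p, q, h.2⟩) (finite_words _ n)

theorem words_eq_iUnion (𝒜 : Automaton Q A) (n : ℕ) :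
    𝒜.words n = ⋃ x : Q × Q, {w : List A | w.length = n ∧ 𝒜.Path x.1 w x.2} := by
  ext w
  simp [words]

theorem ncard_words_edgeAutomaton_le [Fintype Q] [DecidableEq Q] [Finite A]
    (𝒜 : Automaton Q A) (n : ℕ) :
    (𝒜.edgeAutomaton.words n).ncard ≤ ∑ p, ∑ q, (𝒜.adjMatrix ^ n) p q := by
  rw [words_eq_iUnion]
  refine (Set.ncard_iUnion_le_of_fintype _).trans ?_
  rw [Fintype.sum_prod_type]
  simp only [adjMatrix_pow_apply, le_refl]

attribute [local instance] Matrix.linftyOpNormedRing Matrix.linftyOpNormedAlgebra in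
/-- By Gelfand's formula, the logarithm of the spectral radius is the growth rate of the number
of runs. -/
theorem log_spectralRad [Fintype Q] [DecidableEq Q] [Finite A] (hc : 𝒜.StronglyConnected)
    (hne : 𝒜.accepted.Nonempty) :
    Real.log 𝒜.spectralRad = entropy 𝒜.edgeAutomaton.accepted := by
  have hc' := stronglyConnected_edgeAutomaton hc
  have hne' := accepted_edgeAutomaton_nonempty hne
  have hQ : Nonempty Q := by
    obtain ⟨x, r, -⟩ := hne
    exact ⟨r 0⟩
  set N : Matrix Q Q ℂ := 𝒜.adjMatrix.map (fun m : ℕ => (m : ℂ)) with hN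
  have hpow : ∀ n p q, ‖(N ^ n) p q‖ = ((𝒜.adjMatrix ^ n) p q : ℝ) := by
    intro n p q
    have : N ^ n = (𝒜.adjMatrix ^ n).map (fun m : ℕ => (m : ℂ)) :=
      (map_pow (Nat.castRingHom ℂ).mapMatrix 𝒜.adjMatrix n).symm
    rw [this, Matrix.map_apply, Complex.norm_natCast]
  have hnorm : ∀ n, ‖N ^ n‖ = ((Finset.univ.sup fun p => ∑ q, ‖(N ^ n) p q‖₊ : NNReal) : ℝ) :=
    fun n => Matrix.linfty_opNorm_def _
  have hrow : ∀ n p, (∑ q, ((𝒜.adjMatrix ^ n) p q : ℝ)) ≤ ‖N ^ n‖ := by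
    intro n p
    have h1 : ∑ q, ‖(N ^ n) p q‖₊ ≤ Finset.univ.sup fun p => ∑ q, ‖(N ^ n) p q‖₊ :=
      Finset.le_sup (f := fun p => ∑ q, ‖(N ^ n) p q‖₊) (Finset.mem_univ p)
    have h2 : ((∑ q, ‖(N ^ n) p q‖₊ : NNReal) : ℝ) ≤ ‖N ^ n‖ := by
      rw [hnorm]
      exact_mod_cast h1
    simpa [hpow] using h2
  have hx : ∀ n, (0 : ℝ) < (𝒜.edgeAutomaton.words n).ncard := fun n => by
    exact_mod_cast ncard_words_pos hc' hne' n
  have hle : ∀ n, ((𝒜.edgeAutomaton.words n).ncard : ℝ) ≤ Fintype.card Q * ‖N ^ n‖ := by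
    intro n
    calc ((𝒜.edgeAutomaton.words n).ncard : ℝ) ≤ ∑ p, ∑ q, ((𝒜.adjMatrix ^ n) p q : ℝ) := by
          exact_mod_cast ncard_words_edgeAutomaton_le 𝒜 n
      _ ≤ ∑ _p : Q, ‖N ^ n‖ := Finset.sum_le_sum fun p _ => hrow n p
      _ = _ := by simp
  have hge : ∀ n, ‖N ^ n‖ ≤ Fintype.card Q * (𝒜.edgeAutomaton.words n).ncard := by
    intro n
    obtain ⟨p, -, hp⟩ := Finset.exists_mem_eq_sup Finset.univ Finset.univ_nonempty
      fun p => ∑ q, ‖(N ^ n) p q‖₊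
    rw [hnorm, hp]
    push_cast
    simp only [hpow]
    calc ∑ q, ((𝒜.adjMatrix ^ n) p q : ℝ)
        ≤ ∑ _q : Q, ((𝒜.edgeAutomaton.words n).ncard : ℝ) :=
          Finset.sum_le_sum fun q _ => by
            exact_mod_cast adjMatrix_pow_apply_le_ncard_words 𝒜 n p q
      _ = _ := by simp
  have hcard : (0 : ℝ) < Fintype.card Q := by exact_mod_cast Fintype.card_pos
  have hpos : ∀ n, 0 < ‖N ^ n‖ := fun n =>
    pos_of_mul_pos_right ((hx n).trans_le (hle n)) hcard.le
  have hlog := tendsto_log_div_of_le hx hpos hcard hle hge (tendsto_log_words hc' hne')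
  have hlim : Tendsto (fun n : ℕ => ENNReal.ofReal (‖N ^ n‖ ^ (1 / n : ℝ))) atTop
      (𝓝 (ENNReal.ofReal (Real.exp (entropy 𝒜.edgeAutomaton.accepted)))) := by
    refine ENNReal.tendsto_ofReal (((Real.continuous_exp.tendsto _).comp hlog).congr fun n => ?_)
    rw [Real.rpow_def_of_pos (hpos n), mul_one_div, Function.comp_apply]
  have hrad := tendsto_nhds_unique (spectrum.pow_norm_pow_one_div_tendsto_nhds_spectralRadius N)
    hlim
  rw [spectralRad, ← hN, hrad, ENNReal.toReal_ofReal (Real.exp_nonneg _), Real.log_exp]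

theorem words_eq_image_label (𝒜 : Automaton Q A) (n : ℕ) :
    𝒜.words n = label '' 𝒜.edgeAutomaton.words n := by
  ext w
  constructor
  · rintro ⟨hw, p, q, h⟩
    obtain ⟨e, rfl, he⟩ := h.exists_edge
    exact ⟨e, ⟨(length_label e).symm.trans hw, p, q, he⟩, rfl⟩
  · rintro ⟨e, ⟨he, p, q, h⟩, rfl⟩
    exact ⟨(length_label e).trans he, p, q, h.label⟩

/-- In an unambiguous automaton a run is determined by its label and its two ends, so runs and
labels have the same growth rate. -/
theorem Unambiguous.entropy_edgeAutomaton [Finite Q] [Finite A] (hU : 𝒜.Unambiguous)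
    (hc : 𝒜.StronglyConnected) (hne : 𝒜.accepted.Nonempty) :
    entropy 𝒜.edgeAutomaton.accepted = entropy 𝒜.accepted := by
  have := Fintype.ofFinite Q
  have hQ : Nonempty Q := by
    obtain ⟨x, r, -⟩ := hne
    exact ⟨r 0⟩
  have hc' := stronglyConnected_edgeAutomaton hc
  have hne' := accepted_edgeAutomaton_nonempty hne
  have hle : ∀ n, (𝒜.words n).ncard ≤ (𝒜.edgeAutomaton.words n).ncard := fun n => by
    rw [words_eq_image_label]
    exact Set.ncard_image_le (finite_words _ n)
  have hge : ∀ n, (𝒜.edgeAutomaton.words n).ncard ≤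
      Fintype.card (Q × Q) * (𝒜.words n).ncard := by
    intro n
    rw [words_eq_iUnion]
    refine (Set.ncard_iUnion_le_of_fintype _).trans ?_
    refine (Finset.sum_le_card_nsmul _ _ (𝒜.words n).ncard fun x _ => ?_).trans (by simp)
    refine Set.ncard_le_ncard_of_injOn label ?_ ?_ (finite_words _ n)
    · rintro e ⟨he, h⟩
      exact ⟨(length_label e).trans he, _, _, h.label⟩
    · rintro e ⟨-, h⟩ f ⟨-, h'⟩ hef
      exact unambiguous_iff.1 hU _ _ e f h h' hef
  have hcard : (1 : ℝ) ≤ Fintype.card (Q × Q) := by exact_mod_cast Fintype.card_pos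
  refine tendsto_nhds_unique (tendsto_log_words hc' hne') ?_
  refine tendsto_log_div_of_le (C := Fintype.card (Q × Q))
    (fun n => by exact_mod_cast ncard_words_pos hc hne n)
    (fun n => by exact_mod_cast ncard_words_pos hc' hne' n) (by linarith) (fun n => ?_)
    (fun n => by exact_mod_cast hge n) (tendsto_log_words hc hne)
  have h1 : ((𝒜.words n).ncard : ℝ) ≤ (𝒜.edgeAutomaton.words n).ncard := by exact_mod_cast hle n
  exact h1.trans (le_mul_of_one_le_left (Nat.cast_nonneg _) hcard)

/-! ### Ambiguity makes runs grow faster than labels -/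

/-- The runs, as lists of transitions, that are lexicographically minimal among all runs with the
same label and the same ends. -/
def minRuns [LinearOrder (Q × A × Q)] (𝒜 : Automaton Q A) : Set (List (Q × A × Q)) :=
  {e | ∃ p q, 𝒜.edgeAutomaton.Path p e q ∧
    ∀ f, 𝒜.edgeAutomaton.Path p f q → label f = label e → e ≤ f}

theorem minRuns_of_append [LinearOrder (Q × A × Q)] {u v : List (Q × A × Q)}
    (h : u ++ v ∈ 𝒜.minRuns) : u ∈ 𝒜.minRuns := by
  obtain ⟨p, q, hp, hmin⟩ := h
  obtain ⟨s, hu, hv⟩ := path_append.1 hp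
  refine ⟨p, s, hu, fun f hf hfu => ?_⟩
  by_contra! hlt
  have hlen : f.length = u.length := by rw [← length_label f, hfu, length_label]
  refine (hmin (f ++ v) (path_append.2 ⟨s, hf, hv⟩) ?_).not_gt ?_
  · rw [label_append, label_append, hfu]
  · exact lex_append_of_length_eq hlt hlen v v

/-- No run that ends with `d` is minimal if `c` is smaller than `d` and has the same label and the
same ends: replace `d` by `c`. -/
theorem append_notMem_minRuns [LinearOrder (Q × A × Q)] {p q : Q} {c d : List (Q × A × Q)}
    (hc : 𝒜.edgeAutomaton.Path p c q) (hd : 𝒜.edgeAutomaton.Path p d q)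
    (hcd : label c = label d) (hlt : c < d) (u : List (Q × A × Q)) : u ++ d ∉ 𝒜.minRuns := by
  rintro ⟨p', q', hp, hmin⟩
  obtain ⟨s, hu, hv⟩ := path_append.1 hp
  have hlen : c.length = d.length := by rw [← length_label c, hcd, length_label]
  have hd0 : d ≠ [] := by
    rintro rfl
    exact hlt.ne (List.length_eq_zero_iff.1 hlen)
  obtain rfl : s = p := hv.start_eq hd0 hd
  obtain rfl : q' = q := hv.end_eq hd
  refine (hmin (u ++ c) (path_append.2 ⟨s, hu, hc⟩) ?_).not_gt (List.Lex.append_left _ hlt u)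
  rw [label_append, label_append, hcd]

theorem ncard_words_le_minRuns [Finite Q] [Finite A] [LinearOrder (Q × A × Q)] (n : ℕ) :
    (𝒜.words n).ncard ≤ {e ∈ 𝒜.minRuns | e.length = n}.ncard := by
  have hfin : {e ∈ 𝒜.minRuns | e.length = n}.Finite :=
    (List.finite_length_eq _ n).subset fun _ h => h.2
  refine (Set.ncard_le_ncard ?_ (hfin.image label)).trans (Set.ncard_image_le hfin)
  rintro w ⟨hw, p, q, h⟩
  obtain ⟨e, he, hp⟩ := h.exists_edge
  have hF : {f : List (Q × A × Q) | 𝒜.edgeAutomaton.Path p f q ∧ label f = w}.Finite :=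
    (List.finite_length_eq _ n).subset fun f hf => by
      rw [Set.mem_ofPred_eq, ← length_label, hf.2, hw]
  obtain ⟨m, ⟨hm, hmw⟩, hmin⟩ := Set.exists_min_image _ id hF ⟨e, hp, he⟩
  refine ⟨m, ⟨⟨p, q, hm, fun f hf hfm => hmin f ⟨hf, hfm.trans hmw⟩⟩, ?_⟩, hmw⟩
  rw [← length_label, hmw, hw]

/-- If the runs of a strongly connected automaton grow no faster than their labels, then the
automaton is unambiguous. -/
theorem unambiguous_of_entropy_eq [Finite Q] [Finite A] (hc : 𝒜.StronglyConnected)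
    (hne : 𝒜.accepted.Nonempty)
    (h : entropy 𝒜.edgeAutomaton.accepted = entropy 𝒜.accepted) : 𝒜.Unambiguous := by
  classical
  rw [unambiguous_iff]
  by_contra! hcon
  obtain ⟨p, q, c, d, hpc, hpd, hcd, hneq⟩ := hcon
  -- any linear order on the transitions will do
  let := linearOrderOfSTO (WellOrderingRel (α := Q × A × Q))
  wlog hlt : c < d generalizing c d
  · exact this d c hpd hpc hcd.symm hneq.symm (lt_of_le_of_ne (not_lt.1 hlt) hneq.symm)
  have hc' := stronglyConnected_edgeAutomaton hc
  refine not_forall_exp_entropy_le hc' (accepted_edgeAutomaton_nonempty hne) (W := 𝒜.minRuns)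
    (fun _ _ => minRuns_of_append) (fun e ⟨p, q, he, _⟩ => ⟨p, q, he⟩) (fun t => ?_) fun n => ?_
  · obtain ⟨u, hu⟩ := hc'.exists_path t p
    refine ⟨u ++ d, q, path_append.2 ⟨p, hu, hpd⟩, fun w => ?_⟩
    rw [← List.append_assoc]
    exact append_notMem_minRuns hpc hpd hcd hlt _
  · rw [h]
    refine (exp_entropy_le_ncard_words hc hne n).trans ?_
    exact_mod_cast ncard_words_le_minRuns n

/-! ### Proper subshifts of irreducible sofic shifts -/

/-- A shift space properly contained in an irreducible sofic shift has smaller entropy; here the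
smaller one is accepted by a strongly connected automaton as well. -/
theorem accepted_eq_of_entropy_eq {P : Type*} [Finite P] [Finite A] [TopologicalSpace A]
    [DiscreteTopology A] {ℬ : Automaton P A} (hℬ : ℬ.StronglyConnected)
    (hc : 𝒜.StronglyConnected) (hne : 𝒜.accepted.Nonempty) (hshift : IsShiftSpace 𝒜.accepted)
    (hsub : 𝒜.accepted ⊆ ℬ.accepted) (h : entropy 𝒜.accepted = entropy ℬ.accepted) :
    𝒜.accepted = ℬ.accepted := by
  by_contra hneq
  obtain ⟨x, hx, hxY⟩ := Set.exists_of_ssubset (hsub.ssubset_of_ne hneq)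
  obtain ⟨m, hm⟩ := hshift.exists_notMem_factors hxY
  have hne' := hne.mono hsub
  set u := List.ofFn fun i : Fin m => x i with hu
  have hu𝒜 : ∀ p q, ¬ 𝒜.Path p u q := fun p q hp =>
    hm ((mem_factors_accepted hc hne).2 ⟨by simp, p, q, hp⟩)
  obtain ⟨-, p, q, hpq⟩ := (mem_factors_accepted hℬ hne').1
    (⟨x, hx, 0, fun i => by simp⟩ : (fun i : Fin m => x i) ∈ factors ℬ.accepted m)
  refine not_forall_exp_entropy_le hℬ hne' (W := {w | ∃ p q, 𝒜.Path p w q}) ?_ ?_ ?_ ?_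
  · rintro v w ⟨p, q, hp⟩
    obtain ⟨s, hs, -⟩ := path_append.1 hp
    exact ⟨p, s, hs⟩
  · intro w hw
    rw [← List.ofFn_get w] at hw ⊢
    obtain ⟨y, hy, k, hk⟩ := (mem_factors_accepted hc hne).2 ⟨by simp, hw⟩
    exact ((mem_factors_accepted hℬ hne').1 ⟨y, hsub hy, k, hk⟩).2
  · intro t
    obtain ⟨v, hv⟩ := hℬ.exists_path t p
    refine ⟨v ++ u, q, path_append.2 ⟨p, hv, hpq⟩, ?_⟩
    rintro w ⟨p', q', hp'⟩
    obtain ⟨s, -, hs⟩ := path_append.1 hp'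
    obtain ⟨s', -, hs'⟩ := path_append.1 hs
    exact hu𝒜 _ _ hs'
  · intro n
    rw [← h]
    refine (exp_entropy_le_ncard_words hc hne n).trans (le_of_eq ?_)
    congr 2
    ext w
    exact and_comm

end Automaton

end SymbolicDynamicsAutomata

theorem theorem1 {A : Type*} [Finite A] [TopologicalSpace A] [DiscreteTopology A]
    {Q : Type*} [Fintype Q] [DecidableEq Q]
    (X : Set (ℕ → A)) (hX : SymbolicDynamicsAutomata.IsShiftSpace X)
    (h : ℝ) (hh : SymbolicDynamicsAutomata.entropy X = h)
    (𝒜 : SymbolicDynamicsAutomata.Automaton Q A) (hconn : 𝒜.StronglyConnected)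
    (hshift : SymbolicDynamicsAutomata.IsShiftSpace 𝒜.accepted)
    (hne : 𝒜.accepted.Nonempty) (hsub : 𝒜.accepted ⊆ X) :
    (𝒜.Unambiguous → 𝒜.accepted = X → Real.log 𝒜.spectralRad = h) ∧
    (𝒜.accepted = X → Real.log 𝒜.spectralRad = h → 𝒜.Unambiguous) ∧
    (SymbolicDynamicsAutomata.IsIrreducibleSofic X →
      𝒜.Unambiguous → Real.log 𝒜.spectralRad = h → 𝒜.accepted = X) := by
  subst hh
  rw [SymbolicDynamicsAutomata.Automaton.log_spectralRad hconn hne]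
  refine ⟨fun hU hacc => ?_, fun hacc hrad => ?_, ?_⟩
  · rw [hU.entropy_edgeAutomaton hconn hne, hacc]
  · rw [← hacc] at hrad
    exact SymbolicDynamicsAutomata.Automaton.unambiguous_of_entropy_eq hconn hne hrad
  · rintro ⟨P, hP, ℬ, hℬ, rfl⟩ hU hrad
    rw [hU.entropy_edgeAutomaton hconn hne] at hrad
    exact SymbolicDynamicsAutomata.Automaton.accepted_eq_of_entropy_eq hℬ hconn hne hshift hsub
      hrad
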